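/- All Hilbert spaces are finite-dimensional, all logarithms are to base 2 with $\log 0=-\infty$ and $\log\infty=\infty$, and all relative entropies and entropies take values in $[-\infty,\infty]$. Let $\mathcal P(\mathcal H)$ be the positive semidefinite operators on $\mathcal H$, $\mathcal S(\mathcal H)=\{\rho\in\mathcal P(\mathcal H):\operatorname{Tr}\rho=1\}$ and $\mathcal S_\le(\mathcal H)=\{\rho\in\mathcal P(\mathcal H):0<\operatorname{Tr}\rho\le 1\}$. Put $\|X\|_1=\operatorname{Tr}\sqrt{X^\dagger X}$. For $\tau,\rho\in\mathcal S_\le(\mathcal H)$ let $F(\tau,\rho)=\|\sqrt\tau\sqrt\rho\|_1+\sqrt{(1-\operatorname{Tr}\tau)(1-\operatorname{Tr}\rho)}$, let $P(\tau,\rho)=\sqrt{1-F(\tau,\rho)^2}$ be the purified distance, and let $\mathcal B_\delta(\rho)=\{\tau\in\mathcal S_\le(\mathcal H): P(\tau,\rho)\le\delta\}$. For $\rho\in\mathcal S_\le(\mathcal H)$ and $\sigma\in\mathcal P(\mathcal H)$ define $$2^{-D_{\min}(\rho\|\sigma)}=\|\sqrt\rho\sqrt\sigma\|_1^2,\qquad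 D_{\min}^{\delta}(\rho\|\sigma)=\sup_{\tau\in\mathcal B_\delta(\rho)}D_{\min}(\tau\|\sigma),$$ $$2^{-D_H^{\eta}(\rho\|\sigma)}=\tfrac1\eta\min\{\operatorname{Tr}(Q\sigma): 0\le Q\le 1,\ \operatorname{Tr}(Q\rho)\ge\eta\}\quad(\eta>0),\qquad D_H^0(\rho\|\sigma)=\lim_{\eta\downarrow0}D_H^\eta(\rho\|\sigma).$$ For $\rho=\rho_{AB}\in\mathcal S(\mathcal H_A\otimes\mathcal H_B)$ with marginal $\rho_B=\operatorname{Tr}_A\rho_{AB}$ let $$H_H^\eta(A|B)_\rho=-D_H^\eta(\rho_{AB}\,\|\,\mathbb I_A\otimes\rho_B),\qquad H_{\max}^\delta(A|B)_\rho=\inf_{\tau\in\mathcal B_\delta(\rho)}\ \sup_{\sigma_B\in\mathcal S_\le(\mathcal H_B)}-D_{\min}(\tau_{AB}\,\|\,\mathbb I_A\otimes\sigma_B),$$ and $H_{\max}(A|B)_\rho=H_{\max}^0(A|B)_\rho$. **Proposition.** Let $0<\varepsilon\le 1$. 1. For all $\rho\in\mathcal S(\mathcal H)$ and $\sigma\in\mathcal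 P(\mathcal H)$ (in particular whenever $\rho$ and $\sigma$ have intersecting support), $$D_{\min}(\rho\|\sigma)-\log\frac1{\varepsilon^2}\ \le\ D_H^{1-\varepsilon}(\rho\|\sigma),\qquad D_H^{1-\varepsilon}(\rho\|\sigma)+\log\frac1{1-\varepsilon}\ \le\ D_{\min}^{\sqrt{2\varepsilon}}(\rho\|\sigma),$$ where $\log\frac1{1-\varepsilon}=\infty$ for $\varepsilon=1$; hence, for $\varepsilon<1$, $$D_{\min}(\rho\|\sigma)-\log\frac1{\varepsilon^2}\ \le\ D_H^{1-\varepsilon}(\rho\|\sigma)\ \le\ D_{\min}^{\sqrt{2\varepsilon}}(\rho\|\sigma)-\log\frac1{1-\varepsilon}.$$ 2. For every $\rho_{AB}\in\mathcal S(\mathcal H_A\otimes\mathcal H_B)$, $$H_{\max}(A|B)_\rho+\log\frac1{\varepsilon^2}\ \ge\ H_H^{1-\varepsilon}(A|B)_\rho.$$ -/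

import Mathlib

open scoped ComplexOrder

namespace OneShot

open scoped MatrixOrder Kronecker ENNReal

/- Operators on a finite-dimensional Hilbert space are complex matrices indexed by an orthonormal
basis; a bipartite space has the product of the two bases as its basis. -/

section Basic

variable {n : Type*} [Fintype n] [DecidableEq n]

/-- Normalized quantum states: positive semidefinite operators of trace one. -/
def IsState (ρ : Matrix n n ℂ) : Prop :=
  ρ.PosSemidef ∧ ρ.trace.re = 1

/-- Subnormalized quantum states: positive semidefinite operators with `0 < Tr ρ ≤ 1`. -/
def IsSubstate (ρ : Matrix n n ℂ) : Prop :=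
  ρ.PosSemidef ∧ 0 < ρ.trace.re ∧ ρ.trace.re ≤ 1

/-- The trace norm `‖X‖₁ = Tr √(Xᴴ X)`. -/
noncomputable def traceNorm (X : Matrix n n ℂ) : ℝ :=
  (CFC.sqrt (X.conjTranspose * X)).trace.re

/-- The fidelity `‖√ρ √σ‖₁`. -/
noncomputable def fidelity (ρ σ : Matrix n n ℂ) : ℝ :=
  traceNorm (CFC.sqrt ρ * CFC.sqrt σ)

/-- The generalized fidelity of subnormalized states. -/
noncomputable def genFidelity (ρ σ : Matrix n n ℂ) : ℝ :=
  fidelity ρ σ + Real.sqrt ((1 - ρ.trace.re) * (1 - σ.trace.re))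

/-- The purified distance of subnormalized states. -/
noncomputable def purifiedDist (ρ σ : Matrix n n ℂ) : ℝ :=
  Real.sqrt (1 - genFidelity ρ σ ^ 2)

/-- The ball of subnormalized states at purified distance at most `ε` from `ρ`. -/
def purifiedBall (ε : ℝ) (ρ : Matrix n n ℂ) : Set (Matrix n n ℂ) :=
  {τ | IsSubstate τ ∧ purifiedDist τ ρ ≤ ε}

/-- The logarithm to base 2 on `[0, ∞]`, with `log 0 = -∞` and `log ∞ = ∞`. -/
noncomputable def log2 (x : ℝ≥0∞) : EReal :=
  ENNReal.log x / ((Real.log 2 : ℝ) : EReal)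

/-- The tests with success probability at least `ε` on `ρ`: operators `Q` with `0 ≤ Q ≤ 1` and
`Tr (Q ρ) ≥ ε`. -/
def tests (ε : ℝ) (ρ : Matrix n n ℂ) : Set (Matrix n n ℂ) :=
  {Q | Q.PosSemidef ∧ (1 - Q).PosSemidef ∧ ε ≤ (Q * ρ).trace.re}

/-- The hypothesis-testing relative entropy for `ε > 0`, given by
`2 ^ (-D) = (1 / ε) * min {Tr (Q σ) | Q ∈ tests ε ρ}`. -/
noncomputable def DHpos (ε : ℝ) (ρ σ : Matrix n n ℂ) : EReal :=
  -log2 (1 / ENNReal.ofReal ε * ⨅ Q ∈ tests ε ρ, ENNReal.ofReal (Q * σ).trace.re)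

open Classical in
/-- The hypothesis-testing relative entropy. At `ε = 0`, where the defining formula reads
`(1 / 0) * 0`, it is the limit as `ε` decreases to `0`, which is a supremum because the quantity is
antitone in `ε`. -/
noncomputable def DH (ε : ℝ) (ρ σ : Matrix n n ℂ) : EReal :=
  if ε = 0 then ⨆ δ ∈ Set.Ioc (0 : ℝ) 1, DHpos δ ρ σ else DHpos ε ρ σ

/-- The relative min-entropy, `2 ^ (-D) = ‖√ρ √σ‖₁ ^ 2`. -/
noncomputable def Dmin (ρ σ : Matrix n n ℂ) : EReal :=
  -log2 (ENNReal.ofReal (fidelity ρ σ ^ 2))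

/-- The smooth relative min-entropy. -/
noncomputable def DminSmooth (ε : ℝ) (ρ σ : Matrix n n ℂ) : EReal :=
  ⨆ τ ∈ purifiedBall ε ρ, Dmin τ σ

end Basic

section Bipartite

variable {a b : Type*} [Fintype a] [DecidableEq a] [Fintype b] [DecidableEq b]

/-- The marginal `ρ_B = Tr_A ρ_AB`. -/
def marginalB (ρ : Matrix (a × b) (a × b) ℂ) : Matrix b b ℂ :=
  fun j k => ∑ i, ρ (i, j) (i, k)

/-- The hypothesis-testing conditional entropy `H_H^ε(A|B)_ρ = -D_H^ε(ρ_AB ‖ 1_A ⊗ ρ_B)`. -/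
noncomputable def HH (ε : ℝ) (ρ : Matrix (a × b) (a × b) ℂ) : EReal :=
  -DH ε ρ ((1 : Matrix a a ℂ) ⊗ₖ marginalB ρ)

/-- The smooth conditional max-entropy `H_max^ε(A|B)_ρ`. -/
noncomputable def HmaxSmooth (ε : ℝ) (ρ : Matrix (a × b) (a × b) ℂ) : EReal :=
  ⨅ τ ∈ purifiedBall ε ρ, ⨆ σ ∈ {σ : Matrix b b ℂ | IsSubstate σ},
    -Dmin τ ((1 : Matrix a a ℂ) ⊗ₖ σ)

/-- The conditional max-entropy `H_max(A|B)_ρ`: the smooth one at `ε = 0`. -/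
noncomputable def Hmax (ρ : Matrix (a × b) (a × b) ℂ) : EReal :=
  HmaxSmooth 0 ρ

end Bipartite

end OneShot

namespace OneShot

open scoped MatrixOrder Kronecker ENNReal

/-! ### Trace inequalities and polar decomposition. -/

section TraceInequalities

variable {n : Type*} [Fintype n] [DecidableEq n]

/-! Write `F` for the fidelity of `ρ` and `σ`. For the lower bound, let `P` project onto the
positive part of `√ρ - s√σ`. A Powers–Størmer argument (`exists_test_sq`) gives `Tr (1-P)ρ + s² Tr
Pσ ≤ s Tr √ρ√σ ≤ sF` and `s² Tr Pσ ≤ Tr Pρ`. If `sF ≤ ε`, then `P` succeeds with probability at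
least `1-ε`; scaling it down to exactly `1-ε` yields `s² Tr Qσ ≤ 1-ε`, and letting `s` approach
`ε/F` gives `F²/ε²`.

For the upper bound, a test `Q` with `Tr Qρ ≥ η = 1-ε` yields the smoothing candidate `τ = √Q ρ √Q`.
Cauchy–Schwarz bounds its squared fidelity with `σ` by `Tr Qσ`, while its fidelity with `ρ` is at
least `Tr √Q ρ ≥ η`, so its purified distance from `ρ` is at most `√(1-η²) ≤ √(2ε)`. The endpoint `ε
= 1` needs limits in both bounds.

The entropy statement is the lower bound for `σ = 1 ⊗ ρ_B`: the ball of radius zero is `{ρ}`, and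
`ρ_B` competes in the supremum over `σ_B`. -/

lemma continuousOn_spectrum (f : ℝ → ℝ) (A : Matrix n n ℂ) : ContinuousOn f (spectrum ℝ A) :=
  A.finite_real_spectrum.continuousOn f

lemma posSemidef_sqrt (A : Matrix n n ℂ) : (CFC.sqrt A).PosSemidef :=
  Matrix.nonneg_iff_posSemidef.1 (CFC.sqrt_nonneg A)

lemma conjTranspose_sqrt (A : Matrix n n ℂ) : (CFC.sqrt A).conjTranspose = CFC.sqrt A :=
  (posSemidef_sqrt A).isHermitian

lemma sqrt_mul_sqrt {A : Matrix n n ℂ} (hA : A.PosSemidef) : CFC.sqrt A * CFC.sqrt A = A :=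
  CFC.sqrt_mul_sqrt_self A hA.nonneg

omit [DecidableEq n] in
lemma trace_re_nonneg {A : Matrix n n ℂ} (hA : A.PosSemidef) : 0 ≤ A.trace.re :=
  (Complex.le_def.1 hA.trace_nonneg).1

lemma trace_re_mul_nonneg {A B : Matrix n n ℂ} (hA : A.PosSemidef) (hB : B.PosSemidef) :
    0 ≤ (A * B).trace.re := by
  have h := hB.mul_mul_conjTranspose_same (CFC.sqrt A)
  have h2 := trace_re_nonneg h
  rwa [conjTranspose_sqrt, Matrix.trace_mul_comm, ← mul_assoc, sqrt_mul_sqrt hA] at h2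

lemma trace_re_mul_le {A B C : Matrix n n ℂ} (hAB : (B - A).PosSemidef) (hC : C.PosSemidef) :
    (A * C).trace.re ≤ (B * C).trace.re := by
  have h := trace_re_mul_nonneg hAB hC
  rw [sub_mul, Matrix.trace_sub, Complex.sub_re] at h
  linarith

omit [DecidableEq n] in
/-- A Hermitian idempotent is positive semidefinite. -/
lemma posSemidef_of_idempotent {P : Matrix n n ℂ} (hP : P.IsHermitian) (h : P * P = P) :
    P.PosSemidef := by
  have := Matrix.posSemidef_conjTranspose_mul_self P
  rwa [hP.eq, h] at this

lemma one_sub_posSemidef_of_idempotent {P : Matrix n n ℂ} (hP : P.IsHermitian)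
    (h : P * P = P) : (1 - P).PosSemidef :=
  posSemidef_of_idempotent (Matrix.isHermitian_one.sub hP) (by simp [mul_sub, sub_mul, h])

/-- The projection onto the positive part of a Hermitian matrix. -/
lemma exists_positive_projection {D : Matrix n n ℂ} (hD : D.IsHermitian) :
    ∃ P : Matrix n n ℂ, P.PosSemidef ∧ (1 - P).PosSemidef ∧ P * D = D * P ∧
      (P * D).PosSemidef ∧ (P * D - D).PosSemidef := by
  have hD' : IsSelfAdjoint D := hD
  set f : ℝ → ℝ := fun x => if 0 < x then 1 else 0
  have key : cfc f D * D = cfc (fun x => f x * x) D := by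
    rw [cfc_mul f (fun x => x) D (continuousOn_spectrum _ _) (continuousOn_spectrum _ _),
      cfc_id' ℝ D]
  have key' : D * cfc f D = cfc (fun x => f x * x) D := by
    conv_rhs => enter [1]; ext x; rw [mul_comm]
    rw [cfc_mul (fun x => x) f D (continuousOn_spectrum _ _) (continuousOn_spectrum _ _),
      cfc_id' ℝ D]
  refine ⟨cfc f D, ?_, ?_, ?_, ?_, ?_⟩
  · exact Matrix.nonneg_iff_posSemidef.1
      (cfc_nonneg fun x _ => by simp only [f]; split_ifs <;> norm_num)
  · have : 1 - cfc f D = cfc (fun x => 1 - f x) D := by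
      rw [cfc_sub _ _ D (continuousOn_spectrum _ _) (continuousOn_spectrum _ _), cfc_const_one ℝ D]
    rw [this]
    exact Matrix.nonneg_iff_posSemidef.1
      (cfc_nonneg fun x _ => by simp only [f]; split_ifs <;> norm_num)
  · rw [key, key']
  · rw [key]
    refine Matrix.nonneg_iff_posSemidef.1 (cfc_nonneg fun x _ => ?_)
    simp only [f]; split_ifs <;> linarith
  · have : cfc f D * D - D = cfc (fun x => f x * x - x) D := by
      rw [cfc_sub _ _ D (continuousOn_spectrum _ _) (continuousOn_spectrum _ _), cfc_id' ℝ D, key]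
    rw [this]
    refine Matrix.nonneg_iff_posSemidef.1 (cfc_nonneg fun x _ => ?_)
    simp only [f]; split_ifs <;> linarith

/-- A test that discriminates between the squares of two positive semidefinite matrices: the
Powers–Størmer inequality in its test form. -/
lemma exists_test_sq {R T : Matrix n n ℂ} (hR : R.PosSemidef) (hT : T.PosSemidef) :
    ∃ P : Matrix n n ℂ, P.PosSemidef ∧ (1 - P).PosSemidef ∧
      (P * (T * T)).trace.re ≤ (P * (R * R)).trace.re ∧
      ((1 - P) * (R * R)).trace.re + (P * (T * T)).trace.re ≤ (R * T).trace.re := by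
  obtain ⟨P, hP, hP1, hc, hPD, hPD'⟩ :=
    exists_positive_projection (hR.isHermitian.sub hT.isHermitian)
  refine ⟨P, hP, hP1, ?_, ?_⟩
  · have h := trace_re_mul_nonneg hPD (hR.add hT)
    -- `P` commutes with `R - T`, so the cross terms of `Tr P(R-T)(R+T)` cancel.
    have e1 : (P * (R * T)).trace = (P * (T * R)).trace := by
      have h1 : (P * (R - T) * R).trace = (P * R * (R - T)).trace := by
        rw [hc, mul_assoc, Matrix.trace_mul_comm]
      simp only [mul_sub, sub_mul, Matrix.trace_sub, mul_assoc] at h1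
      linear_combination h1
    simp only [mul_sub, sub_mul, mul_add, Matrix.trace_sub, Matrix.trace_add, mul_assoc,
      Complex.sub_re, Complex.add_re, e1] at h
    linarith
  · have h1 := trace_re_mul_nonneg hPD hT
    have h2 := trace_re_mul_nonneg hPD' hR
    have e1 : (P * (R * T)).trace = (P * (T * R)).trace := by
      have h1 : (P * (R - T) * R).trace = (P * R * (R - T)).trace := by
        rw [hc, mul_assoc, Matrix.trace_mul_comm]
      simp only [mul_sub, sub_mul, Matrix.trace_sub, mul_assoc] at h1
      linear_combination h1
    have e2 : (T * R).trace = (R * T).trace := Matrix.trace_mul_comm _ _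
    simp only [mul_sub, sub_mul, Matrix.trace_sub, mul_assoc, Complex.sub_re, one_mul, e1, e2]
      at h1 h2 ⊢
    linarith

/-- The Moore–Penrose inverse of a Hermitian matrix. -/
lemma exists_pseudoinverse {R : Matrix n n ℂ} (hR : R.IsHermitian) :
    ∃ G : Matrix n n ℂ, G.IsHermitian ∧ G * R = R * G ∧ R * G * R = R ∧ G * R * G = G := by
  have hR' : IsSelfAdjoint R := hR
  have hc (f : ℝ → ℝ) := continuousOn_spectrum f R
  have h1 : cfc (fun x : ℝ => x⁻¹) R * R = cfc (fun x : ℝ => x⁻¹ * x) R := by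
    rw [cfc_mul _ _ R (hc _) (hc _), cfc_id' ℝ R]
  have h2 : R * cfc (fun x : ℝ => x⁻¹) R = cfc (fun x : ℝ => x * x⁻¹) R := by
    rw [cfc_mul _ _ R (hc _) (hc _), cfc_id' ℝ R]
  -- The convention `0⁻¹ = 0` makes this the pseudoinverse on the kernel too.
  refine ⟨cfc (fun x : ℝ => x⁻¹) R, (cfc_predicate _ R : IsSelfAdjoint _), ?_, ?_, ?_⟩
  · rw [h1, h2]; congr 1; ext x; ring
  · rw [h2]
    conv_lhs => enter [2]; rw [← cfc_id' ℝ R]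
    rw [← cfc_mul _ _ R (hc _) (hc _)]
    conv_rhs => rw [← cfc_id' ℝ R]
    congr 1; ext x; exact mul_inv_mul_cancel x
  · rw [h1, ← cfc_mul _ _ R (hc _) (hc _)]
    congr 1; ext x; simpa using mul_inv_mul_cancel x⁻¹

/-- A polar decomposition: the trace norm of `X` is the trace of `W * X` for a partial
isometry `W`. -/
lemma exists_polar (X : Matrix n n ℂ) :
    ∃ W : Matrix n n ℂ, (1 - W.conjTranspose * W).PosSemidef ∧
      W * X = CFC.sqrt (X.conjTranspose * X) ∧
      W.conjTranspose * CFC.sqrt (X.conjTranspose * X) = X := by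
  set R := CFC.sqrt (X.conjTranspose * X)
  have hR : R.IsHermitian := (posSemidef_sqrt _).isHermitian
  have hRR : R * R = X.conjTranspose * X :=
    sqrt_mul_sqrt (Matrix.posSemidef_conjTranspose_mul_self X)
  obtain ⟨G, hG, hc, h1, h2⟩ := exists_pseudoinverse hR
  have hGs : G.conjTranspose = G := hG
  have hW : (G * X.conjTranspose).conjTranspose = X * G := by
    rw [Matrix.conjTranspose_mul, Matrix.conjTranspose_conjTranspose, hGs]
  have e1 : G * X.conjTranspose * (X * G) = R * G := by
    calc G * X.conjTranspose * (X * G) = G * (X.conjTranspose * X) * G := by noncomm_ring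
      _ = (G * R) * (R * G) := by rw [← hRR]; noncomm_ring
      _ = (R * G * R) * G := by rw [hc]; noncomm_ring
      _ = R * G := by rw [h1]
  -- `X` and `R` have the same kernel since `XᴴX = R²`, and `1 - R * G` projects onto it.
  have e2 : X * (R * G) = X := by
    have h : (X - X * (R * G)).conjTranspose * (X - X * (R * G)) = 0 := by
      have hRGs : (R * G).conjTranspose = R * G := by
        rw [Matrix.conjTranspose_mul, hGs, hR.eq, hc]
      calc (X - X * (R * G)).conjTranspose * (X - X * (R * G))
          = (1 - R * G) * (X.conjTranspose * X) * (1 - R * G) := by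
            rw [Matrix.conjTranspose_sub, Matrix.conjTranspose_mul, hRGs]; noncomm_ring
        _ = (R - R * G * R) * (R - R * (R * G)) := by rw [← hRR]; noncomm_ring
        _ = 0 := by rw [h1]; simp
    have := Matrix.conjTranspose_mul_self_eq_zero.1 h
    exact (sub_eq_zero.1 this).symm
  refine ⟨G * X.conjTranspose, ?_, ?_, ?_⟩
  · rw [hW]
    refine one_sub_posSemidef_of_idempotent ?_ ?_
    · rw [Matrix.IsHermitian, Matrix.conjTranspose_mul, hW, Matrix.conjTranspose_mul, hGs]
    · calc X * G * (G * X.conjTranspose) * (X * G * (G * X.conjTranspose))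
          = X * G * (G * X.conjTranspose * (X * G)) * (G * X.conjTranspose) := by noncomm_ring
        _ = X * (G * R * G) * (G * X.conjTranspose) := by rw [e1]; noncomm_ring
        _ = X * G * (G * X.conjTranspose) := by rw [h2]
  · calc G * X.conjTranspose * X = G * (X.conjTranspose * X) := by noncomm_ring
      _ = (G * R) * R := by rw [← hRR]; noncomm_ring
      _ = R := by rw [hc, h1]
  · rw [hW, mul_assoc, hc, e2]

omit [DecidableEq n] in
/-- The Cauchy–Schwarz inequality for the Hilbert–Schmidt inner product. -/
lemma trace_re_mul_sq_le (A B : Matrix n n ℂ) :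
    (A * B).trace.re ^ 2 ≤
      (A * A.conjTranspose).trace.re * (B.conjTranspose * B).trace.re := by
  have key (t : ℝ) : 0 ≤ (A * A.conjTranspose).trace.re * (t * t) +
      (-2 * (A * B).trace.re) * t + (B.conjTranspose * B).trace.re := by
    have h := trace_re_nonneg (Matrix.posSemidef_conjTranspose_mul_self
      ((t : ℂ) • A.conjTranspose - B))
    have e : (B.conjTranspose * A.conjTranspose).trace.re = (A * B).trace.re := by
      rw [← Matrix.conjTranspose_mul, Matrix.trace_conjTranspose]; simp
    simp only [Matrix.conjTranspose_sub, Matrix.conjTranspose_smul,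
      Matrix.conjTranspose_conjTranspose, sub_mul, mul_sub, Matrix.smul_mul, Matrix.mul_smul,
      Matrix.trace_sub, Matrix.trace_smul, Complex.sub_re, smul_eq_mul, Complex.star_def,
      Complex.conj_ofReal, Complex.re_ofReal_mul, e] at h
    linarith
  have := discrim_le_zero key
  rw [discrim] at this
  linarith

lemma traceNorm_nonneg (X : Matrix n n ℂ) : 0 ≤ traceNorm X :=
  trace_re_nonneg (posSemidef_sqrt _)

lemma fidelity_nonneg (ρ σ : Matrix n n ℂ) : 0 ≤ fidelity ρ σ := traceNorm_nonneg _

/-- Cauchy–Schwarz applied to `√S Wᴴ` and `√S`, where `X = Wᴴ S` is the polar form and `W` a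
contraction. -/
lemma trace_re_le_traceNorm (X : Matrix n n ℂ) : X.trace.re ≤ traceNorm X := by
  obtain ⟨W, hW, -, hX⟩ := exists_polar X
  set S := CFC.sqrt (X.conjTranspose * X) with hS
  have hSp : S.PosSemidef := posSemidef_sqrt _
  set K := CFC.sqrt S
  have hK : K * K = S := sqrt_mul_sqrt hSp
  have hKs : K.conjTranspose = K := conjTranspose_sqrt S
  have h1 := trace_re_mul_sq_le (K * W.conjTranspose) K
  have e1 : (K * W.conjTranspose * K).trace = X.trace := by
    rw [Matrix.trace_mul_comm, ← mul_assoc, hK, Matrix.trace_mul_comm, hX]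
  have e2 : (K * W.conjTranspose * (K * W.conjTranspose).conjTranspose).trace.re ≤ S.trace.re := by
    have h2 := trace_re_mul_le hW hSp
    rw [one_mul] at h2
    rwa [Matrix.conjTranspose_mul, Matrix.conjTranspose_conjTranspose, hKs, ← mul_assoc,
      Matrix.trace_mul_comm, ← mul_assoc, ← mul_assoc, hK, mul_assoc, Matrix.trace_mul_comm]
  have h0 := trace_re_nonneg hSp
  rw [e1, hKs, hK] at h1
  have h3 : X.trace.re ^ 2 ≤ S.trace.re ^ 2 :=
    h1.trans ((mul_le_mul_of_nonneg_right e2 h0).trans_eq (sq _).symm)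
  exact abs_le_of_sq_le_sq' h3 h0 |>.2

/-- The trace norm of a product is at most the product of the Hilbert–Schmidt norms. -/
lemma traceNorm_mul_sq_le (A B : Matrix n n ℂ) :
    traceNorm (A * B) ^ 2 ≤
      (A.conjTranspose * A).trace.re * (B.conjTranspose * B).trace.re := by
  obtain ⟨W, hW, hX, -⟩ := exists_polar (A * B)
  have h := trace_re_mul_sq_le (W * A) B
  rw [mul_assoc, hX] at h
  refine h.trans (mul_le_mul_of_nonneg_right ?_
    (trace_re_nonneg (Matrix.posSemidef_conjTranspose_mul_self B)))
  have h2 := trace_re_mul_le hW (Matrix.posSemidef_self_mul_conjTranspose A)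
  rw [one_mul, Matrix.trace_mul_comm A] at h2
  rwa [Matrix.conjTranspose_mul, ← mul_assoc, Matrix.trace_mul_comm, ← mul_assoc, ← mul_assoc,
    mul_assoc _ A]

end TraceInequalities

/-! ### The extended logarithm. -/

section Logarithm

/-- The inverse of `log2`. -/
noncomputable def exp2 (y : EReal) : ℝ≥0∞ :=
  EReal.exp (y * ((Real.log 2 : ℝ) : EReal))

/-- Moves bounds on logarithms into `[0, ∞]`, where infima and limits can be taken. -/
lemma le_log2_iff {y : EReal} {x : ℝ≥0∞} : y ≤ log2 x ↔ exp2 y ≤ x := by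
  have h2 : (0 : EReal) < ((Real.log 2 : ℝ) : EReal) := by
    exact_mod_cast Real.log_pos one_lt_two
  rw [log2, EReal.le_div_iff_mul_le h2 (EReal.coe_ne_top _), exp2, ← ENNReal.log_le_log_iff,
    EReal.log_exp]

lemma log2_mono {x y : ℝ≥0∞} (h : x ≤ y) : log2 x ≤ log2 y :=
  le_log2_iff.2 ((le_log2_iff.1 le_rfl).trans h)

lemma log2_zero : log2 0 = ⊥ := by
  rw [log2, ENNReal.log_zero]
  exact EReal.bot_div_of_pos_ne_top (by exact_mod_cast Real.log_pos one_lt_two)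
    (EReal.coe_ne_top _)

lemma log2_mul (x y : ℝ≥0∞) : log2 (x * y) = log2 x + log2 y := by
  rw [log2, ENNReal.log_mul_add, EReal.add_div_of_nonneg_right]
  · rfl
  · exact_mod_cast Real.log_nonneg one_le_two

lemma exists_log2_ofReal_eq {x : ℝ} (hx : 0 < x) :
    ∃ r : ℝ, log2 (ENNReal.ofReal x) = (r : EReal) :=
  ⟨Real.log x / Real.log 2, by rw [log2, ENNReal.log_ofReal_of_pos hx, EReal.coe_div]⟩

end Logarithm

/-! ### Lower bound on the hypothesis-testing entropy. -/

section HypothesisTesting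

variable {n : Type*} [Fintype n] [DecidableEq n]

/-- A test whose error probabilities are controlled by the fidelity. -/
lemma exists_test_of_fidelity_le {ρ σ : Matrix n n ℂ} (hρ : IsState ρ) (hσ : σ.PosSemidef)
    {ε s : ℝ} (hε1 : ε < 1) (hs : 0 ≤ s) (h : s * fidelity ρ σ ≤ ε) :
    ∃ Q ∈ tests (1 - ε) ρ, s ^ 2 * (Q * σ).trace.re ≤ 1 - ε := by
  have hT : ((s : ℂ) • CFC.sqrt σ).PosSemidef :=
    (posSemidef_sqrt σ).smul (by exact_mod_cast hs)
  obtain ⟨P, hP, hP1, h1, h2⟩ := exists_test_sq (posSemidef_sqrt ρ) hT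
  have hF : (CFC.sqrt ρ * CFC.sqrt σ).trace.re ≤ fidelity ρ σ := trace_re_le_traceNorm _
  simp only [Matrix.smul_mul, Matrix.mul_smul, sqrt_mul_sqrt hρ.1, sqrt_mul_sqrt hσ,
    Matrix.trace_smul, smul_eq_mul, Complex.re_ofReal_mul, sub_mul, one_mul, Matrix.trace_sub,
    Complex.sub_re, hρ.2] at h1 h2
  have hsF := mul_le_mul_of_nonneg_left hF hs
  have hPσ : 0 ≤ s * (s * (P * σ).trace.re) := by
    have := trace_re_mul_nonneg hP hσ
    positivity
  set q := (P * ρ).trace.re with hq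
  have hq1 : 1 - ε ≤ q := by linarith
  have hq0 : 0 < q := by linarith
  -- Scaling by `c` makes the success probability exactly `1 - ε`, which turns `s² Tr Pσ ≤ q` into
  -- the required bound.
  set c := (1 - ε) / q with hc
  have hc0 : 0 ≤ c := div_nonneg (by linarith) hq0.le
  have hc1 : c ≤ 1 := (div_le_one hq0).2 hq1
  have hcq : c * q = 1 - ε := div_mul_cancel₀ _ hq0.ne'
  refine ⟨(c : ℂ) • P, ⟨hP.smul (by exact_mod_cast hc0), ?_, ?_⟩, ?_⟩
  · have e : 1 - (c : ℂ) • P = (1 - P) + ((1 - c : ℝ) : ℂ) • P := by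
      push_cast; rw [sub_smul, one_smul]; abel
    rw [e]
    exact hP1.add (hP.smul (by exact_mod_cast sub_nonneg.2 hc1))
  · rw [Matrix.smul_mul, Matrix.trace_smul, smul_eq_mul, Complex.re_ofReal_mul, ← hq, hcq]
  · rw [Matrix.smul_mul, Matrix.trace_smul, smul_eq_mul, Complex.re_ofReal_mul]
    nlinarith [mul_le_mul_of_nonneg_left h1 hc0]

/-- The ideal scale `s = ε / F` is undefined when `F = 0`, so `s = x^(-1/2)` with `x = F²/ε² + δ` is
used and `δ` is arbitrary. -/
lemma iInf_tests_le_fidelity {ρ σ : Matrix n n ℂ} (hρ : IsState ρ) (hσ : σ.PosSemidef)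
    {ε : ℝ} (hε0 : 0 < ε) (hε1 : ε < 1) :
    1 / ENNReal.ofReal (1 - ε) * ⨅ Q ∈ tests (1 - ε) ρ, ENNReal.ofReal (Q * σ).trace.re ≤
      ENNReal.ofReal (fidelity ρ σ ^ 2 / ε ^ 2) := by
  refine ENNReal.le_of_forall_pos_le_add fun δ hδ _ => ?_
  set F := fidelity ρ σ with hF
  have hF0 : 0 ≤ F := fidelity_nonneg ρ σ
  have hδ' : (0 : ℝ) < δ := hδ
  set x : ℝ := F ^ 2 / ε ^ 2 + δ with hx
  have hx0 : 0 < x := by positivity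
  have hs : (Real.sqrt x)⁻¹ * F ≤ ε := by
    rw [inv_mul_le_iff₀ (Real.sqrt_pos.2 hx0), mul_comm]
    rw [← div_le_iff₀' hε0]
    apply Real.le_sqrt_of_sq_le
    rw [div_pow]; linarith
  obtain ⟨Q, hQ, h⟩ := exists_test_of_fidelity_le hρ hσ hε1 (inv_nonneg.2 (Real.sqrt_nonneg x)) hs
  rw [inv_pow, Real.sq_sqrt hx0.le, inv_mul_le_iff₀ hx0] at h
  have e : ENNReal.ofReal (F ^ 2 / ε ^ 2) + (δ : ℝ≥0∞) = ENNReal.ofReal x := by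
    rw [hx, ENNReal.ofReal_add (by positivity) hδ'.le, ENNReal.ofReal_coe_nnreal]
  rw [e, one_div, mul_comm, ← div_eq_mul_inv]
  refine ENNReal.div_le_of_le_mul ?_
  rw [← ENNReal.ofReal_mul hx0.le]
  exact (iInf₂_le Q hQ).trans (ENNReal.ofReal_le_ofReal h)

lemma one_div_ofReal {x : ℝ} (hx : 0 < x) :
    1 / ENNReal.ofReal x = ENNReal.ofReal (1 / x) := by
  rw [ENNReal.ofReal_div_of_pos hx, ENNReal.ofReal_one]

lemma one_div_ofReal_sq {x : ℝ} (hx : 0 < x) :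
    1 / ENNReal.ofReal x ^ 2 = ENNReal.ofReal (1 / x ^ 2) := by
  rw [← ENNReal.ofReal_pow hx.le, one_div_ofReal (by positivity)]

lemma ofReal_div_sq (x : ℝ) {ε : ℝ} (hε : 0 < ε) (hx : 0 ≤ x) :
    ENNReal.ofReal (x / ε ^ 2) = ENNReal.ofReal x * (1 / ENNReal.ofReal ε ^ 2) := by
  rw [one_div_ofReal_sq hε, ← ENNReal.ofReal_mul hx, mul_one_div]

lemma Dmin_sub_log2 (ρ σ : Matrix n n ℂ) {ε : ℝ} (hε : 0 < ε) :
    Dmin ρ σ - log2 (1 / ENNReal.ofReal ε ^ 2) =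
      -log2 (ENNReal.ofReal (fidelity ρ σ ^ 2 / ε ^ 2)) := by
  obtain ⟨r, hr⟩ := exists_log2_ofReal_eq (x := 1 / ε ^ 2) (by positivity)
  rw [ofReal_div_sq _ hε (sq_nonneg _), log2_mul, one_div_ofReal_sq hε, hr, Dmin,
    EReal.neg_add (.inr (EReal.coe_ne_top r)) (.inr (EReal.coe_ne_bot r))]

lemma DHpos_le_DH_zero {δ : ℝ} (h0 : 0 < δ) (h1 : δ ≤ 1) (ρ σ : Matrix n n ℂ) :
    DHpos δ ρ σ ≤ DH 0 ρ σ := by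
  rw [DH, if_pos rfl]
  exact le_iSup₂_of_le (f := fun δ (_ : δ ∈ Set.Ioc (0 : ℝ) 1) => DHpos δ ρ σ) δ ⟨h0, h1⟩ le_rfl

theorem Dmin_sub_log2_le_DH {ρ σ : Matrix n n ℂ} (hρ : IsState ρ) (hσ : σ.PosSemidef)
    {ε : ℝ} (hε0 : 0 < ε) (hε1 : ε ≤ 1) :
    Dmin ρ σ - log2 (1 / ENNReal.ofReal ε ^ 2) ≤ DH (1 - ε) ρ σ := by
  have hpos {ε : ℝ} (hε0 : 0 < ε) (hε1 : ε < 1) :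
      -log2 (ENNReal.ofReal (fidelity ρ σ ^ 2 / ε ^ 2)) ≤ DHpos (1 - ε) ρ σ :=
    EReal.neg_le_neg_iff.2 (log2_mono (iInf_tests_le_fidelity hρ hσ hε0 hε1))
  rw [Dmin_sub_log2 ρ σ hε0]
  rcases hε1.lt_or_eq with h | rfl
  · rw [DH, if_neg (by linarith)]
    exact hpos hε0 h
  · rw [sub_self, EReal.neg_le, le_log2_iff]
    -- At `ε = 1`, the bounds for smaller `ε` all sit below the supremum `DH 0`; let `ε` increase to
    -- 1.
    have key : ∀ᶠ ε in nhdsWithin (1 : ℝ) (Set.Iio 1),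
        exp2 (-DH 0 ρ σ) ≤ ENNReal.ofReal (fidelity ρ σ ^ 2 / ε ^ 2) := by
      filter_upwards [Ioo_mem_nhdsLT (zero_lt_one' ℝ)] with ε hε
      rw [← le_log2_iff, EReal.neg_le]
      exact (hpos hε.1 hε.2).trans
        (DHpos_le_DH_zero (by linarith [hε.2]) (by linarith [hε.1]) ρ σ)
    refine ge_of_tendsto (ENNReal.tendsto_ofReal ?_) key
    have : ContinuousAt (fun ε : ℝ => fidelity ρ σ ^ 2 / ε ^ 2) 1 :=
      continuousAt_const.div (by fun_prop) (by norm_num)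
    exact this.tendsto.mono_left nhdsWithin_le_nhds

end HypothesisTesting

/-! ### Upper bound through the post-measurement state. -/

section Smoothing

variable {n : Type*} [Fintype n] [DecidableEq n]

/-- Functional calculus for `x ≤ √x` on `[0, 1]`. -/
lemma sqrt_sub_self_posSemidef {Q : Matrix n n ℂ} (hQ : Q.PosSemidef)
    (hQ1 : (1 - Q).PosSemidef) : (CFC.sqrt Q - Q).PosSemidef := by
  have hs : IsSelfAdjoint Q := hQ.isHermitian
  have hc (f : ℝ → ℝ) := continuousOn_spectrum f Q
  have h1 : 1 - Q = cfc (fun x : ℝ => 1 - x) Q := by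
    rw [cfc_sub _ _ Q (hc _) (hc _), cfc_const_one ℝ Q, cfc_id' ℝ Q]
  have h2 : Q = cfc (fun x : ℝ => x) Q := (cfc_id' ℝ Q).symm
  have h3 : CFC.sqrt Q - Q = cfc (fun x : ℝ => Real.sqrt x - x) Q := by
    rw [cfc_sub _ _ Q (hc _) (hc _), cfc_id' ℝ Q, CFC.sqrt_eq_real_sqrt Q hQ.nonneg,
      cfcₙ_eq_cfc (hf := Real.continuous_sqrt.continuousOn) (hf0 := Real.sqrt_zero)]
  have p1 := hQ1.nonneg
  rw [h1, cfc_nonneg_iff _ _ (hc _)] at p1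
  have p2 := hQ.nonneg
  rw [h2, cfc_nonneg_iff _ _ (hc _)] at p2
  rw [h3]
  refine Matrix.nonneg_iff_posSemidef.1 (cfc_nonneg fun x hx => ?_)
  have := p1 x hx
  exact sub_nonneg.2 (Real.le_sqrt_of_sq_le (by nlinarith [p2 x hx]))

/-- The unnormalized post-measurement state of the test `Q`. -/
noncomputable def postMeasurement (Q ρ : Matrix n n ℂ) : Matrix n n ℂ :=
  CFC.sqrt Q * ρ * CFC.sqrt Q

lemma postMeasurement_posSemidef (Q : Matrix n n ℂ) {ρ : Matrix n n ℂ} (hρ : ρ.PosSemidef) :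
    (postMeasurement Q ρ).PosSemidef := by
  have := hρ.mul_mul_conjTranspose_same (CFC.sqrt Q)
  rwa [conjTranspose_sqrt] at this

lemma trace_postMeasurement {Q : Matrix n n ℂ} (hQ : Q.PosSemidef) (ρ : Matrix n n ℂ) :
    (postMeasurement Q ρ).trace = (Q * ρ).trace := by
  rw [postMeasurement, Matrix.trace_mul_comm, ← mul_assoc, sqrt_mul_sqrt hQ]

/-- The trace norm of `X` depends only on `XᴴX`, here `√σ √Q ρ √Q √σ` on both sides; this avoids
computing the root of the post-measurement state. -/
lemma fidelity_postMeasurement (Q : Matrix n n ℂ) {ρ : Matrix n n ℂ} (hρ : ρ.PosSemidef)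
    (σ : Matrix n n ℂ) :
    fidelity (postMeasurement Q ρ) σ = traceNorm (CFC.sqrt ρ * (CFC.sqrt Q * CFC.sqrt σ)) := by
  rw [fidelity, traceNorm, traceNorm]
  congr 3
  simp only [Matrix.conjTranspose_mul, conjTranspose_sqrt]
  calc CFC.sqrt σ * CFC.sqrt (postMeasurement Q ρ) * (CFC.sqrt (postMeasurement Q ρ) * CFC.sqrt σ)
      = CFC.sqrt σ * (CFC.sqrt (postMeasurement Q ρ) * CFC.sqrt (postMeasurement Q ρ)) *
          CFC.sqrt σ := by noncomm_ring
    _ = CFC.sqrt σ * (CFC.sqrt Q * (CFC.sqrt ρ * CFC.sqrt ρ) * CFC.sqrt Q) * CFC.sqrt σ := by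
        rw [sqrt_mul_sqrt (postMeasurement_posSemidef Q hρ), sqrt_mul_sqrt hρ, postMeasurement]
    _ = _ := by noncomm_ring

lemma fidelity_postMeasurement_sq_le {Q ρ σ : Matrix n n ℂ} (hQ : Q.PosSemidef)
    (hρ : IsState ρ) (hσ : σ.PosSemidef) :
    fidelity (postMeasurement Q ρ) σ ^ 2 ≤ (Q * σ).trace.re := by
  rw [fidelity_postMeasurement Q hρ.1]
  refine (traceNorm_mul_sq_le _ _).trans_eq ?_
  rw [conjTranspose_sqrt, sqrt_mul_sqrt hρ.1, hρ.2, one_mul, Matrix.conjTranspose_mul,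
    conjTranspose_sqrt, conjTranspose_sqrt, mul_assoc, Matrix.trace_mul_comm,
    ← mul_assoc (CFC.sqrt Q), sqrt_mul_sqrt hQ, mul_assoc, sqrt_mul_sqrt hσ]

lemma le_fidelity_postMeasurement {η : ℝ} {Q ρ : Matrix n n ℂ} (hρ : ρ.PosSemidef)
    (hQ : Q ∈ tests η ρ) : η ≤ fidelity (postMeasurement Q ρ) ρ := by
  rw [fidelity_postMeasurement Q hρ]
  refine le_trans ?_ (trace_re_le_traceNorm _)
  rw [Matrix.trace_mul_comm, mul_assoc, sqrt_mul_sqrt hρ]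
  exact hQ.2.2.trans (trace_re_mul_le (sqrt_sub_self_posSemidef hQ.1 hQ.2.1) hρ)

lemma genFidelity_of_isState (τ : Matrix n n ℂ) {ρ : Matrix n n ℂ} (hρ : IsState ρ) :
    genFidelity τ ρ = fidelity τ ρ := by
  simp [genFidelity, hρ.2]

lemma postMeasurement_mem_purifiedBall {η δ : ℝ} {Q ρ : Matrix n n ℂ} (hρ : IsState ρ)
    (hη : 0 < η) (hδ : Real.sqrt (1 - η ^ 2) ≤ δ) (hQ : Q ∈ tests η ρ) :
    postMeasurement Q ρ ∈ purifiedBall δ ρ := by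
  refine ⟨⟨postMeasurement_posSemidef Q hρ.1, ?_, ?_⟩, ?_⟩
  · rw [trace_postMeasurement hQ.1]
    exact hη.trans_le hQ.2.2
  · rw [trace_postMeasurement hQ.1]
    have := trace_re_mul_le hQ.2.1 hρ.1
    rwa [one_mul, hρ.2] at this
  · refine le_trans (Real.sqrt_le_sqrt ?_) hδ
    rw [genFidelity_of_isState _ hρ]
    have := pow_le_pow_left₀ hη.le (le_fidelity_postMeasurement hρ.1 hQ) 2
    linarith

lemma neg_DminSmooth_le_log2 {η δ : ℝ} {Q ρ σ : Matrix n n ℂ} (hρ : IsState ρ)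
    (hσ : σ.PosSemidef) (hη : 0 < η) (hδ : Real.sqrt (1 - η ^ 2) ≤ δ) (hQ : Q ∈ tests η ρ) :
    -DminSmooth δ ρ σ ≤ log2 (ENNReal.ofReal (Q * σ).trace.re) := by
  rw [EReal.neg_le]
  refine le_trans ?_ (le_iSup₂ (f := fun τ (_ : τ ∈ purifiedBall δ ρ) => Dmin τ σ) _
    (postMeasurement_mem_purifiedBall hρ hη hδ hQ))
  exact EReal.neg_le_neg_iff.2 (log2_mono (ENNReal.ofReal_le_ofReal
    (fidelity_postMeasurement_sq_le hQ.1 hρ hσ)))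

lemma smul_one_mem_tests {ρ : Matrix n n ℂ} (hρ : IsState ρ) {t : ℝ} (h0 : 0 ≤ t) (h1 : t ≤ 1) :
    (t : ℂ) • (1 : Matrix n n ℂ) ∈ tests t ρ := by
  refine ⟨Matrix.PosSemidef.one.smul (by exact_mod_cast h0), ?_, ?_⟩
  · have e : (1 : Matrix n n ℂ) - (t : ℂ) • 1 = ((1 - t : ℝ) : ℂ) • 1 := by
      push_cast; rw [sub_smul, one_smul]
    rw [e]
    exact Matrix.PosSemidef.one.smul (by exact_mod_cast sub_nonneg.2 h1)
  · simp [hρ.2]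

/-- A ball of radius at least 1 contains the post-measurement states `tρ` of the trivial tests `t •
1`; let `t` tend to 0. -/
lemma DminSmooth_eq_top {ρ σ : Matrix n n ℂ} (hρ : IsState ρ) (hσ : σ.PosSemidef) {δ : ℝ}
    (hδ : 1 ≤ δ) : DminSmooth δ ρ σ = ⊤ := by
  have key : ∀ᶠ t in nhdsWithin (0 : ℝ) (Set.Ioi 0),
      exp2 (-DminSmooth δ ρ σ) ≤ ENNReal.ofReal (t * σ.trace.re) := by
    filter_upwards [Ioo_mem_nhdsGT (zero_lt_one' ℝ)] with t ht
    have h := neg_DminSmooth_le_log2 hρ hσ ht.1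
      ((Real.sqrt_le_one.2 (by nlinarith [ht.1])).trans hδ)
      (smul_one_mem_tests hρ ht.1.le ht.2.le)
    rw [le_log2_iff] at h
    simpa using h
  have lim : Filter.Tendsto (fun t : ℝ => ENNReal.ofReal (t * σ.trace.re))
      (nhdsWithin (0 : ℝ) (Set.Ioi 0)) (nhds (ENNReal.ofReal (0 * σ.trace.re))) :=
    ENNReal.tendsto_ofReal (((continuous_id.mul continuous_const).tendsto (0 : ℝ)).mono_left
      nhdsWithin_le_nhds)
  have h := ge_of_tendsto lim key
  rw [zero_mul, ENNReal.ofReal_zero, ← le_log2_iff, log2_zero, le_bot_iff] at h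
  simpa using h

theorem DH_add_log2_le_DminSmooth {ρ σ : Matrix n n ℂ} (hρ : IsState ρ) (hσ : σ.PosSemidef)
    {ε : ℝ} (hε0 : 0 < ε) (hε1 : ε ≤ 1) :
    DH (1 - ε) ρ σ + log2 (1 / ENNReal.ofReal (1 - ε)) ≤
      DminSmooth (Real.sqrt (2 * ε)) ρ σ := by
  rcases hε1.lt_or_eq with h | rfl
  · obtain ⟨r, hr⟩ := exists_log2_ofReal_eq (x := 1 / (1 - ε)) (one_div_pos.2 (by linarith))
    rw [DH, if_neg (by linarith), DHpos, log2_mul, one_div_ofReal (by linarith), hr,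
      EReal.neg_add (.inl (EReal.coe_ne_bot r)) (.inl (EReal.coe_ne_top r)), sub_eq_add_neg,
      add_right_comm, ← EReal.coe_neg, ← EReal.coe_add, neg_add_cancel, EReal.coe_zero, zero_add,
      EReal.neg_le, le_log2_iff]
    refine le_iInf₂ fun Q hQ => ?_
    rw [← le_log2_iff]
    -- The radius fits because `1 - (1-ε)² = 2ε - ε² ≤ 2ε`.
    exact neg_DminSmooth_le_log2 hρ hσ (by linarith) (Real.sqrt_le_sqrt (by nlinarith)) hQ
  · rw [DminSmooth_eq_top hρ hσ (Real.one_le_sqrt.2 (by norm_num))]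
    exact le_top

end Smoothing

/-! ### Conditional max-entropy. -/

section MaxEntropy

variable {n : Type*} [Fintype n] [DecidableEq n]

/-- States are determined by unit fidelity. -/
lemma eq_of_one_le_fidelity {τ ρ : Matrix n n ℂ} (hτ : IsSubstate τ) (hρ : IsState ρ)
    (h : 1 ≤ fidelity τ ρ) : τ = ρ := by
  obtain ⟨W, hW, hX, -⟩ := exists_polar (CFC.sqrt τ * CFC.sqrt ρ)
  have hF : 1 ≤ (W * (CFC.sqrt τ * CFC.sqrt ρ)).trace.re := by rw [hX]; exact h
  set S := CFC.sqrt τ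
  set R := CFC.sqrt ρ
  have hSs : S.conjTranspose = S := conjTranspose_sqrt τ
  have hRs : R.conjTranspose = R := conjTranspose_sqrt ρ
  have hSS : S * S = τ := sqrt_mul_sqrt hτ.1
  have hRR : R * R = ρ := sqrt_mul_sqrt hρ.1
  have hWτ := trace_re_mul_le hW hτ.1
  rw [one_mul] at hWτ
  have e1 : (W * S * (S * W.conjTranspose)).trace = (W.conjTranspose * W * τ).trace := by
    rw [← hSS, ← mul_assoc, Matrix.trace_mul_comm]; simp only [mul_assoc]
  have e2 : (R * (S * W.conjTranspose)).trace.re = (W * (S * R)).trace.re := by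
    rw [← Complex.conj_re, ← Complex.star_def, ← Matrix.trace_conjTranspose]
    simp only [Matrix.conjTranspose_mul, Matrix.conjTranspose_conjTranspose, hSs, hRs, mul_assoc]
  have hpos : ((W * S - R) * (W * S - R).conjTranspose).PosSemidef :=
    Matrix.posSemidef_self_mul_conjTranspose _
  -- The trace expands to `Tr WτWᴴ - 2 Tr WSR + Tr ρ ≤ 1 - 2 + 1`.
  have htr : ((W * S - R) * (W * S - R).conjTranspose).trace.re ≤ 0 := by
    rw [Matrix.conjTranspose_sub, Matrix.conjTranspose_mul, hSs, hRs]
    simp only [sub_mul, mul_sub, Matrix.trace_sub, Complex.sub_re, e1, e2, hRR, hρ.2]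
    rw [mul_assoc W S R]
    linarith [hτ.2.2]
  have hzero {M : Matrix n n ℂ} (hM : M.PosSemidef) (h : M.trace.re ≤ 0) : M = 0 := by
    refine hM.trace_eq_zero_iff.1 (Complex.ext (le_antisymm h (trace_re_nonneg hM)) ?_)
    exact (Complex.le_def.1 hM.trace_nonneg).2.symm
  have hWS : W * S = R :=
    sub_eq_zero.1 (Matrix.self_mul_conjTranspose_eq_zero.1 (hzero hpos htr))
  -- With `WS = R`, `τ - ρ = S(1 - WᴴW)S` is positive; its trace is at most 0, so it vanishes.
  have hle : (τ - ρ).PosSemidef := by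
    have h1 := hW.mul_mul_conjTranspose_same S
    have e : S * (1 - W.conjTranspose * W) * S.conjTranspose = τ - ρ := by
      calc S * (1 - W.conjTranspose * W) * S.conjTranspose
          = S * S - (W * S).conjTranspose * (W * S) := by
            rw [Matrix.conjTranspose_mul, hSs]; noncomm_ring
        _ = τ - ρ := by rw [hWS, hRs, hSS, hRR]
    rwa [e] at h1
  refine sub_eq_zero.1 (hzero hle ?_)
  rw [Matrix.trace_sub, Complex.sub_re, hρ.2]
  linarith [hτ.2.2]

lemma eq_of_mem_purifiedBall_zero {τ ρ : Matrix n n ℂ} (hρ : IsState ρ)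
    (h : τ ∈ purifiedBall 0 ρ) : τ = ρ := by
  refine eq_of_one_le_fidelity h.1 hρ ?_
  have h2 := Real.sqrt_eq_zero'.1 (le_antisymm h.2 (Real.sqrt_nonneg _))
  rw [genFidelity_of_isState _ hρ] at h2
  exact (one_le_sq_iff₀ (fidelity_nonneg τ ρ)).1 (by linarith)

variable {a b : Type*} [Fintype a] [DecidableEq a] [Fintype b] [DecidableEq b]

omit [DecidableEq a] [DecidableEq b] in
lemma isState_marginalB {ρ : Matrix (a × b) (a × b) ℂ} (hρ : IsState ρ) :
    IsState (marginalB ρ) := by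
  have e : marginalB ρ = ∑ i : a, ρ.submatrix (fun j => (i, j)) (fun j => (i, j)) := by
    ext j k; simp [marginalB, Matrix.sum_apply]
  refine ⟨?_, ?_⟩
  · rw [e]
    exact Matrix.posSemidef_sum _ fun i _ => hρ.1.submatrix _
  · rw [← hρ.2]
    simp only [Matrix.trace, Matrix.diag, marginalB, Fintype.sum_prod_type]
    rw [Finset.sum_comm]

lemma neg_Dmin_marginalB_le_Hmax {ρ : Matrix (a × b) (a × b) ℂ} (hρ : IsState ρ) :
    -Dmin ρ ((1 : Matrix a a ℂ) ⊗ₖ marginalB ρ) ≤ Hmax ρ := by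
  refine le_iInf₂ fun τ hτ => ?_
  rw [eq_of_mem_purifiedBall_zero hρ hτ]
  have h := isState_marginalB hρ
  exact le_iSup₂ (f := fun σ (_ : σ ∈ {σ : Matrix b b ℂ | IsSubstate σ}) =>
    -Dmin ρ ((1 : Matrix a a ℂ) ⊗ₖ σ)) (marginalB ρ) ⟨h.1, by rw [h.2]; norm_num, h.2.le⟩

theorem HH_le_Hmax_add_log2 {ρ : Matrix (a × b) (a × b) ℂ} (hρ : IsState ρ) {ε : ℝ}
    (hε0 : 0 < ε) (hε1 : ε ≤ 1) :
    HH (1 - ε) ρ ≤ Hmax ρ + log2 (1 / ENNReal.ofReal ε ^ 2) := by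
  have h := Dmin_sub_log2_le_DH hρ
    (Matrix.PosSemidef.one.kronecker (isState_marginalB hρ).1 :
      ((1 : Matrix a a ℂ) ⊗ₖ marginalB ρ).PosSemidef) hε0 hε1
  obtain ⟨r, hr⟩ := exists_log2_ofReal_eq (x := 1 / ε ^ 2) (by positivity)
  rw [one_div_ofReal_sq hε0, hr] at h ⊢
  refine (EReal.neg_le_neg_iff.2 h).trans ?_
  rw [EReal.neg_sub (.inr (EReal.coe_ne_bot r)) (.inr (EReal.coe_ne_top r))]
  exact add_le_add_left (neg_Dmin_marginalB_le_Hmax hρ) _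

end MaxEntropy

end OneShot

theorem mainTheorem2
    {n a b : Type*} [Fintype n] [DecidableEq n] [Fintype a] [DecidableEq a]
    [Fintype b] [DecidableEq b] (ε : ℝ) (hε0 : 0 < ε) (hε1 : ε ≤ 1) :
    (∀ ρ σ : Matrix n n ℂ, OneShot.IsState ρ → σ.PosSemidef →
      OneShot.Dmin ρ σ - OneShot.log2 (1 / ENNReal.ofReal ε ^ 2) ≤ OneShot.DH (1 - ε) ρ σ ∧
      OneShot.DH (1 - ε) ρ σ + OneShot.log2 (1 / ENNReal.ofReal (1 - ε)) ≤
        OneShot.DminSmooth (Real.sqrt (2 * ε)) ρ σ ∧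
      (ε < 1 → OneShot.DH (1 - ε) ρ σ ≤
        OneShot.DminSmooth (Real.sqrt (2 * ε)) ρ σ -
          OneShot.log2 (1 / ENNReal.ofReal (1 - ε)))) ∧
    (∀ ρ : Matrix (a × b) (a × b) ℂ, OneShot.IsState ρ →
      OneShot.HH (1 - ε) ρ ≤
        OneShot.Hmax ρ + OneShot.log2 (1 / ENNReal.ofReal ε ^ 2)) := by
  refine ⟨fun ρ σ hρ hσ => ⟨OneShot.Dmin_sub_log2_le_DH hρ hσ hε0 hε1,
    OneShot.DH_add_log2_le_DminSmooth hρ hσ hε0 hε1, fun h => ?_⟩,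
    fun ρ hρ => OneShot.HH_le_Hmax_add_log2 hρ hε0 hε1⟩
  obtain ⟨r, hr⟩ := OneShot.exists_log2_ofReal_eq (x := 1 / (1 - ε))
    (one_div_pos.2 (by linarith))
  have h2 := OneShot.DH_add_log2_le_DminSmooth hρ hσ hε0 hε1
  rw [OneShot.one_div_ofReal (by linarith), hr] at h2 ⊢
  exact (EReal.le_sub_iff_add_le (.inl (EReal.coe_ne_bot r)) (.inl (EReal.coe_ne_top r))).2 h2
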